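/- Let $m\ge 2$ and $n=m-2$. An unfolding model of codimension one consists of $m$ objects $\mu_1,\dots,\mu_m\in\mathbb{R}^{n}$ that are generic, meaning that their perpendicular bisectors are in general position: for every partition of $\{1,\dots,m\}$ into $k$ blocks, the set of points $y\in\mathbb{R}^n$ with $\|y-\mu_i\|=\|y-\mu_j\|$ whenever $i,j$ lie in the same block is a nonempty affine subspace of dimension $n-(m-k)=k-2$ if $k\ge 2$, and is empty if $k=1$. Its ranking pattern is the set of all permutations $\sigma\in\mathfrak{S}_m$ for which there is a $y\in\mathbb{R}^n$ with $\|y-\mu_{\sigma(1)}\|<\dots<\|y-\mu_{\sigma(m)}\|$. Two ranking patterns $R,R'$ are equivalent if they differ by a relabelling of the objects, i.e. $R'=\{\tau\sigma\mid\sigma\in R\}$ for some $\tau\in\mathfrak{S}_m$. Let $H_0=\{x\in\mathbb{R}^m\mid x_1+\dots+x_m=0\}$, let $\mathcal{A}$ be the braid arrangement in $H_0$, consisting of the hyperplanes $\{x\in H_0\mid x_i=x_j\}$ for $1\le i<j\le m$, and let $\mathcal{B}$ be the restricted all-subset arrangement, consisting of the hyperplanes $\{x\in H_0\mid\sum_{i\in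 I}x_i=0\}$ for $\emptyset\ne I\subsetneq\{1,\dots,m\}$. Write $\mathbf{Ch}(\mathcal{A}\cup\mathcal{B})$ for the set of chambers of $\mathcal{A}\cup\mathcal{B}$, i.e. the connected components of the complement in $H_0$ of the union of all these hyperplanes. Theorem. The number of equivalence classes of ranking patterns of unfolding models of codimension one with $m$ objects is $$\frac{|\mathbf{Ch}(\mathcal{A}\cup\mathcal{B})|}{m!}-1 .$$ -/

import Mathlib

/-! ### Hyperplane arrangements and their chambers -/

/-- The chambers of an arrangement of hyperplanes: the connected components of the complement of
the union of its members. -/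
def chambers {V : Type*} [TopologicalSpace V] (A : Set (Set V)) : Set (Set V) :=
  {c | ∃ x ∈ (⋃₀ A)ᶜ, c = connectedComponentIn (⋃₀ A)ᶜ x}

/-- The hyperplane `H₀ = {x ∈ ℝᵐ | x₁ + ⋯ + xₘ = 0}` of `ℝᵐ`. -/
def H0 (m : ℕ) : Submodule ℝ (EuclideanSpace ℝ (Fin m)) where
  carrier := {x | ∑ i, x i = 0}
  zero_mem' := by simp
  add_mem' := by
    intro x y hx hy
    simp only [Set.mem_ofPred_eq] at hx hy ⊢
    simp [Finset.sum_add_distrib, hx, hy]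
  smul_mem' := by
    intro c x hx
    simp only [Set.mem_ofPred_eq] at hx ⊢
    simp [← Finset.mul_sum, hx]

/-- The braid arrangement in `H₀`: the hyperplanes `xᵢ = xⱼ` for `i < j`. -/
def braidArrangement (m : ℕ) : Set (Set (H0 m)) :=
  {H | ∃ i j : Fin m, i < j ∧
    H = {x : H0 m | (x : EuclideanSpace ℝ (Fin m)) i = (x : EuclideanSpace ℝ (Fin m)) j}}

/-- The restricted all-subset arrangement in `H₀`: the hyperplanes `∑_{i ∈ I} xᵢ = 0` for the
nonempty proper subsets `I` of the index set. -/
def restrictedAllSubsetArrangement (m : ℕ) : Set (Set (H0 m)) :=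
  {H | ∃ I : Finset (Fin m), I.Nonempty ∧ I ≠ Finset.univ ∧
    H = {x : H0 m | ∑ i ∈ I, (x : EuclideanSpace ℝ (Fin m)) i = 0}}

/-! ### Unfolding models -/

/-- The points that are equidistant from all objects of each class of the partition `r` of the
set of objects; this is an intersection of perpendicular bisectors. -/
def equidistantSet {m n : ℕ} (μ : Fin m → EuclideanSpace ℝ (Fin n)) (r : Setoid (Fin m)) :
    Set (EuclideanSpace ℝ (Fin n)) :=
  {y | ∀ i j, r i j → dist y (μ i) = dist y (μ j)}

/-- The objects `μ₁, …, μₘ ∈ ℝⁿ` are generic: their perpendicular bisectors are in general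
position, i.e. for each partition of the objects into `k` classes, the `m - k` independent
equidistance conditions that it imposes cut out a flat of dimension exactly `n - (m - k)`
if `m - k ≤ n`, and have no common solution if `m - k > n`. -/
def IsGenericUnfolding {m n : ℕ} (μ : Fin m → EuclideanSpace ℝ (Fin n)) : Prop :=
  ∀ r : Setoid (Fin m),
    (m ≤ n + Nat.card (Quotient r) →
      (equidistantSet μ r).Nonempty ∧
        Module.finrank ℝ (vectorSpan ℝ (equidistantSet μ r)) + m = n + Nat.card (Quotient r)) ∧
    (n + Nat.card (Quotient r) < m → equidistantSet μ r = ∅)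

/-- The ranking pattern of the unfolding model with objects `μ₁, …, μₘ ∈ ℝⁿ`: the set of all
rankings `σ` (`σ k` is the object in position `k`) that are generated by some individual
`y ∈ ℝⁿ`, who prefers nearer objects to farther ones:
`‖y - μ_{σ(1)}‖ < ⋯ < ‖y - μ_{σ(m)}‖`. -/
def rankingPattern {m n : ℕ} (μ : Fin m → EuclideanSpace ℝ (Fin n)) :
    Set (Equiv.Perm (Fin m)) :=
  {σ | ∃ y : EuclideanSpace ℝ (Fin n), StrictMono fun k => dist y (μ (σ k))}

/-- The ranking patterns of the (generic) unfolding models with `m` objects in `ℝⁿ`. -/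
def UnfoldingRankingPattern (m n : ℕ) : Type :=
  {S : Set (Equiv.Perm (Fin m)) //
    ∃ μ : Fin m → EuclideanSpace ℝ (Fin n), IsGenericUnfolding μ ∧ rankingPattern μ = S}

/-- Two ranking patterns are equivalent if a relabelling `τ` of the objects carries one to the
other. -/
def rankingPatternSetoid (m n : ℕ) : Setoid (UnfoldingRankingPattern m n) where
  r S T := ∃ τ : Equiv.Perm (Fin m), T.1 = (fun σ => τ * σ) '' S.1
  iseqv :=
    { refl := fun S => ⟨1, by simp⟩
      symm := by
        rintro S T ⟨τ, h⟩
        exact ⟨τ⁻¹, by rw [h, Set.image_image]; simp⟩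
      trans := by
        rintro S T U ⟨τ, h⟩ ⟨τ', h'⟩
        exact ⟨τ' * τ, by rw [h', h, Set.image_image]; simp [mul_assoc]⟩ }

/-- The number of inequivalent ranking patterns of unfolding models with `m` objects in `ℝⁿ`. -/
noncomputable def numInequivalentRankingPatterns (m n : ℕ) : ℕ :=
  Nat.card (Quotient (rankingPatternSetoid m n))

/-! ### Sign patterns of subset sums -/

/-! A generic model has one affine dependency `v` up to scaling: `∑ v i = 0`, `∑ v i • μ i = 0`.
Hence `∑ v i * dist y (μ i) ^ 2` is a constant `c`; genericity makes `c ≠ 0`, and the sign of `v` is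
chosen so that `c > 0`. Up to a common additive constant, the vectors of squared distances fill the
hyperplane `∑ v i * x i = c`. So `σ` is a ranking iff this hyperplane contains a vector increasing
along `σ`, which by Abel summation means that some set of last-placed objects has positive weight
(`IsAdapted.rankingPattern_eq`).

The pattern thus depends only on the signs of the subset sums of `v`, and determines them
(`weightRankings_eq_iff`). Genericity of the objects forces all proper subset sums to be nonzero.
Conversely, a generic `v` comes from a model exactly when at least two coordinates are positive
(`exists_two_pos`, `exists_isAdapted_of_two_pos`).

Relabelling permutes `v`, so each class has an increasing representative, and its sign pattern is
unique by an exchange argument (`positiveSubsets_eq_of_strictMono`). Chambers of the joint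
arrangement are pairs (order of coordinates, increasing sign pattern), whence the factor `m!`; the
`-1` removes the one increasing pattern with a single positive coordinate. -/

/-- The coordinates of `v` sum to zero, and no nonempty proper subset of them does. -/
def SubsetGeneric {ι : Type*} [Fintype ι] (v : ι → ℝ) : Prop :=
  ∑ i, v i = 0 ∧ ∀ I : Finset ι, I.Nonempty → I ≠ Finset.univ → ∑ i ∈ I, v i ≠ 0

/-- The sets of coordinates of `v` with positive sum. -/
def positiveSubsets {ι : Type*} (v : ι → ℝ) : Set (Finset ι) :=
  {I | 0 < ∑ i ∈ I, v i}

/-- The rankings for which some set of last-placed objects has positive weight. -/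
def weightRankings {m : ℕ} (v : Fin m → ℝ) : Set (Equiv.Perm (Fin m)) :=
  {σ | ∃ S : Finset (Fin m), IsUpperSet (S : Set (Fin m)) ∧ 0 < ∑ j ∈ S, v (σ j)}

section Subsets

variable {ι : Type*}

theorem mem_positiveSubsets {v : ι → ℝ} {I : Finset ι} :
    I ∈ positiveSubsets v ↔ 0 < ∑ i ∈ I, v i := Iff.rfl

theorem mem_positiveSubsets_comp {κ : Type*} (v : ι → ℝ) (e : κ ≃ ι) (I : Finset κ) :
    I ∈ positiveSubsets (v ∘ e) ↔ I.map e.toEmbedding ∈ positiveSubsets v := by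
  simp [positiveSubsets]

theorem positiveSubsets_comp_congr {κ : Type*} {v w : ι → ℝ}
    (h : positiveSubsets v = positiveSubsets w) (e : κ ≃ ι) :
    positiveSubsets (v ∘ e) = positiveSubsets (w ∘ e) := by
  ext I
  rw [mem_positiveSubsets_comp, mem_positiveSubsets_comp, h]

variable [Fintype ι]

theorem SubsetGeneric.comp {κ : Type*} [Fintype κ] {v : ι → ℝ} (hv : SubsetGeneric v)
    (e : κ ≃ ι) : SubsetGeneric (v ∘ e) := by
  refine ⟨?_, fun I hI hI' h0 => ?_⟩
  · rw [← hv.1]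
    exact e.sum_comp v
  · refine hv.2 (I.map e.toEmbedding) (by simpa using hI) (fun h => hI' ?_) (by simpa using h0)
    apply Finset.map_injective e.toEmbedding
    rw [h]
    simp

theorem SubsetGeneric.sum_neg_iff {v : ι → ℝ} (hv : SubsetGeneric v) {I : Finset ι}
    (hI : I.Nonempty) (hI' : I ≠ Finset.univ) :
    ∑ i ∈ I, v i < 0 ↔ I ∉ positiveSubsets v := by
  have := hv.2 I hI hI'
  rw [mem_positiveSubsets, not_lt, lt_iff_le_and_ne]
  exact and_iff_left this

/-- Exactly one of a nonempty proper set and its complement has positive sum, so an inclusion of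
sign patterns is already an equality. -/
theorem SubsetGeneric.positiveSubsets_eq_iff {v w : ι → ℝ} (hv : SubsetGeneric v)
    (hw : SubsetGeneric w) :
    positiveSubsets v = positiveSubsets w ↔
      ∀ I ∈ positiveSubsets w, I ∈ positiveSubsets v := by
  classical
  refine ⟨fun h I hI => h ▸ hI, fun h => Set.Subset.antisymm (fun I hI => ?_) h⟩
  by_contra hI'
  have hne : I.Nonempty := by
    rw [Finset.nonempty_iff_ne_empty]
    rintro rfl
    simp [positiveSubsets] at hI
  have hun : I ≠ Finset.univ := by
    rintro rfl
    simp [positiveSubsets, hv.1] at hI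
  have h1 := (hw.sum_neg_iff hne hun).2 hI'
  have h2 : Iᶜ ∈ positiveSubsets w := by
    rw [mem_positiveSubsets]
    have := Finset.sum_add_sum_compl I w
    rw [hw.1] at this
    linarith
  have h3 := h _ h2
  rw [mem_positiveSubsets] at h3 hI
  have := Finset.sum_add_sum_compl I v
  rw [hv.1] at this
  linarith

/-- Exchanging two coordinates towards the order of another weight with the same sign pattern
does not change the sign pattern. -/
theorem positiveSubsets_comp_swap [DecidableEq ι] {u v : ι → ℝ} (hu : SubsetGeneric u)
    (h : positiveSubsets u = positiveSubsets v) {i j : ι} (hv : v i ≤ v j) (huij : u j ≤ u i) :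
    positiveSubsets (u ∘ Equiv.swap i j) = positiveSubsets u := by
  rw [(hu.comp _).positiveSubsets_eq_iff hu]
  intro I hI
  by_cases hij : i = j
  · subst hij
    simpa using hI
  have hsum : ∀ w : ι → ℝ, ∑ k ∈ I.map (Equiv.swap i j).toEmbedding, w k =
      ∑ k ∈ I, w k + (if i ∈ I then w j - w i else 0) + (if j ∈ I then w i - w j else 0) := by
    intro w
    rw [Finset.sum_map]
    have : ∀ k, w (Equiv.swap i j k) =
        w k + (if i = k then w j - w i else 0) + (if j = k then w i - w j else 0) := by
      intro k
      by_cases h1 : k = i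
      · subst h1
        simp [Ne.symm hij]
      · by_cases h2 : k = j
        · subst h2
          simp [hij]
        · simp [Equiv.swap_apply_of_ne_of_ne h1 h2, Ne.symm h1, Ne.symm h2]
    simp only [Equiv.coe_toEmbedding, this, Finset.sum_add_distrib, Finset.sum_ite_eq]
  have hIv : 0 < ∑ k ∈ I, v k := by
    rw [h] at hI
    exact hI
  rw [mem_positiveSubsets_comp]
  -- If only `i` lies in `I`, the swap does not lower the `v`-sum; if only `j` does, it does not
  -- lower the `u`-sum. Either weight may be used, as the patterns agree.
  by_cases hi : i ∈ I <;> by_cases hj : j ∈ I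
  · rw [mem_positiveSubsets, hsum, if_pos hi, if_pos hj]
    rw [mem_positiveSubsets] at hI
    linarith
  · rw [h, mem_positiveSubsets, hsum, if_pos hi, if_neg hj]
    linarith
  · rw [mem_positiveSubsets, hsum, if_neg hi, if_pos hj]
    rw [mem_positiveSubsets] at hI
    linarith
  · rw [mem_positiveSubsets, hsum, if_neg hi, if_neg hj]
    rw [mem_positiveSubsets] at hI
    linarith

/-- Weights with distinct coordinates and with the same sign pattern can be chosen near
any weight. -/
theorem SubsetGeneric.exists_injective {m : ℕ} {v : Fin m → ℝ} (hv : SubsetGeneric v) :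
    ∃ w : Fin m → ℝ, SubsetGeneric w ∧ Function.Injective w ∧
      positiveSubsets w = positiveSubsets v := by
  classical
  -- A centred direction with distinct entries: `v + t * d` keeps total zero and breaks all ties,
  -- while strict inequalities survive for small `t > 0`.
  let d : Fin m → ℝ := fun i => (i : ℝ) - (∑ j : Fin m, (j : ℝ)) / m
  have hd : ∑ i, d i = 0 := by
    rcases Nat.eq_zero_or_pos m with rfl | hm
    · simp
    · have : (m : ℝ) ≠ 0 := by positivity
      simp only [d, Finset.sum_sub_distrib, Finset.sum_const, Finset.card_univ, Fintype.card_fin,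
        nsmul_eq_mul]
      field_simp
      ring
  have hlim : ∀ a b : ℝ, Filter.Tendsto (fun t : ℝ => a + t * b) (nhdsWithin 0 (Set.Ioi 0))
      (nhds a) := by
    intro a b
    have : Filter.Tendsto (fun t : ℝ => a + t * b) (nhds 0) (nhds (a + 0 * b)) :=
      Continuous.tendsto (by fun_prop) 0
    simp only [zero_mul, add_zero] at this
    exact this.mono_left nhdsWithin_le_nhds
  have h1 : ∀ᶠ t : ℝ in nhdsWithin 0 (Set.Ioi 0), ∀ I : Finset (Fin m),
      (0 < ∑ i ∈ I, v i → 0 < ∑ i ∈ I, v i + t * ∑ i ∈ I, d i) ∧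
      (∑ i ∈ I, v i < 0 → ∑ i ∈ I, v i + t * ∑ i ∈ I, d i < 0) := by
    rw [Filter.eventually_all]
    intro I
    rw [Filter.eventually_and]
    constructor
    · by_cases h : 0 < ∑ i ∈ I, v i
      · filter_upwards [(hlim _ (∑ i ∈ I, d i)).eventually (lt_mem_nhds h)] with t ht _ using ht
      · simp [h]
    · by_cases h : ∑ i ∈ I, v i < 0
      · filter_upwards [(hlim _ (∑ i ∈ I, d i)).eventually (gt_mem_nhds h)] with t ht _ using ht
      · simp [h]
  have h2 : ∀ᶠ t : ℝ in nhdsWithin 0 (Set.Ioi 0), ∀ i j : Fin m, i ≠ j →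
      v i + t * d i ≠ v j + t * d j := by
    rw [Filter.eventually_all]
    intro i
    rw [Filter.eventually_all]
    intro j
    by_cases hij : i = j
    · simp [hij]
    by_cases hvij : v i = v j
    · filter_upwards [self_mem_nhdsWithin] with t ht _ h
      have ht' : (0 : ℝ) < t := ht
      rw [hvij, add_right_inj, mul_right_inj' ht'.ne'] at h
      simp only [d, sub_left_inj, Nat.cast_inj] at h
      exact hij (Fin.ext h)
    · have h0 := (hlim (v i - v j) (d i - d j)).eventually_ne (sub_ne_zero.2 hvij)
      filter_upwards [h0] with t ht _ h
      apply ht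
      linarith
  obtain ⟨t, ht1, ht2⟩ := (h1.and h2).exists
  have hsum : ∀ I : Finset (Fin m), ∑ i ∈ I, (v i + t * d i) =
      ∑ i ∈ I, v i + t * ∑ i ∈ I, d i := by
    intro I
    rw [Finset.sum_add_distrib, Finset.mul_sum]
  have hw : SubsetGeneric (fun i => v i + t * d i) := by
    refine ⟨by rw [hsum, hv.1, hd]; simp, fun I hI hI' => ?_⟩
    rw [hsum]
    rcases lt_or_gt_of_ne (hv.2 I hI hI') with h | h
    · exact ((ht1 I).2 h).ne
    · exact ((ht1 I).1 h).ne'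
  refine ⟨fun i => v i + t * d i, hw, fun i j hij => ?_, ?_⟩
  · by_contra h
    exact ht2 i j h hij
  · rw [hw.positiveSubsets_eq_iff hv]
    intro I hI
    rw [mem_positiveSubsets, hsum]
    exact (ht1 I).1 hI

end Subsets

/-! ### Rankings determined by a weight -/

section Rankings

variable {m : ℕ}

/-- An increasing weight is determined up to sign pattern by its sign pattern up to relabelling. -/
theorem positiveSubsets_eq_of_strictMono {v w : Fin m → ℝ} (hw : SubsetGeneric w)
    (hvm : StrictMono v) (hwm : StrictMono w) (τ : Equiv.Perm (Fin m))
    (h : positiveSubsets (w ∘ τ) = positiveSubsets v) :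
    positiveSubsets w = positiveSubsets v := by
  classical
  -- Rearrangement argument: if a maximiser inverted a pair, swapping that pair would keep the sign
  -- pattern and increase the correlation with `v`. So the maximiser is monotone, hence the
  -- identity.
  obtain ⟨π, hπ, hmax⟩ := Finset.exists_max_image
    (Finset.univ.filter fun π : Equiv.Perm (Fin m) =>
      positiveSubsets (w ∘ π) = positiveSubsets v) (fun π => ∑ i, v i * w (π i)) ⟨τ, by simpa⟩
  simp only [Finset.mem_filter, Finset.mem_univ, true_and] at hπ hmax
  have hmono : Monotone π := by
    intro i j hij
    by_contra! hlt
    have hne : i ≠ j := by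
      rintro rfl
      exact lt_irrefl _ hlt
    have hlt' : i < j := lt_of_le_of_ne hij hne
    have h1 : positiveSubsets ((w ∘ π) ∘ Equiv.swap i j) = positiveSubsets (w ∘ π) :=
      positiveSubsets_comp_swap (hw.comp π) hπ (hvm hlt').le (hwm hlt).le
    have h2 := hmax (π * Equiv.swap i j) (h1.trans hπ)
    have h3 : ∑ k, v k * w ((π * Equiv.swap i j) k) - ∑ k, v k * w (π k) =
        (v j - v i) * (w (π i) - w (π j)) := by
      rw [← Finset.sum_sub_distrib, ← Finset.sum_subset (Finset.subset_univ {i, j})]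
      · rw [Finset.sum_pair hne]
        simp
        ring
      · intro k _ hk
        simp only [Finset.mem_insert, Finset.mem_singleton, not_or] at hk
        simp [Equiv.swap_apply_of_ne_of_ne hk.1 hk.2]
    have h4 : 0 < (v j - v i) * (w (π i) - w (π j)) :=
      mul_pos (sub_pos.2 (hvm hlt')) (sub_pos.2 (hwm hlt))
    linarith
  have hid : π = 1 := by
    have hs : StrictMono π := hmono.strictMono_of_injective π.injective
    ext i
    exact congrArg Fin.val (congrFun (StrictMono.range_inj (f := π) (g := id) hs strictMono_id |>.1
      (by simp [π.surjective.range_eq])) i)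
  rw [hid] at hπ
  exact hπ

theorem mem_weightRankings_iff {v : Fin m → ℝ} {σ : Equiv.Perm (Fin m)} :
    σ ∈ weightRankings v ↔ ∃ S : Finset (Fin m), IsUpperSet (S : Set (Fin m)) ∧
      S.map σ.toEmbedding ∈ positiveSubsets v := by
  simp [weightRankings, positiveSubsets]

theorem weightRankings_comp (v : Fin m → ℝ) (τ : Equiv.Perm (Fin m)) :
    weightRankings v = (fun σ => τ * σ) '' weightRankings (v ∘ τ) := by
  ext σ
  constructor
  · intro h
    exact ⟨τ⁻¹ * σ, by simpa [weightRankings] using h, by simp⟩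
  · rintro ⟨ρ, h, rfl⟩
    simpa [weightRankings] using h

/-- A set of negative weight is the set of last-placed objects of a ranking all of whose sets of
last-placed objects have nonpositive weight. -/
theorem SubsetGeneric.exists_notMem_weightRankings {v : Fin m → ℝ} (hv : SubsetGeneric v)
    {I : Finset (Fin m)} (hI : ∑ i ∈ I, v i < 0) :
    ∃ σ ∉ weightRankings v, ∃ S : Finset (Fin m), IsUpperSet (S : Set (Fin m)) ∧
      S.map σ.toEmbedding = I := by
  classical
  -- The ranking puts `I` last and, inside `I` and inside its complement, the positive coordinates
  -- before the others.
  let key : Fin m → ℕ := fun i => (if i ∈ I then 2 else 0) + (if v i ≤ 0 then 1 else 0)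
  have hmono := Tuple.monotone_sort key
  set σ := Tuple.sort key with hσ
  have hlt : ∀ a b, key (σ a) < key (σ b) → a < b := by
    intro a b hab
    by_contra! h
    exact absurd (hmono h) (not_le.2 hab)
  refine ⟨σ, ?_, I.map σ.symm.toEmbedding, ?_, ?_⟩
  · rw [mem_weightRankings_iff]
    rintro ⟨S, hS, hpos⟩
    set T := S.map σ.toEmbedding with hT
    have hup : ∀ i ∈ T, ∀ j, key i < key j → j ∈ T := by
      intro i hi j hij
      rw [hT, Finset.mem_map_equiv] at hi ⊢
      exact hS (hlt _ _ (by simpa using hij)).le hi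
    rw [mem_positiveSubsets] at hpos
    -- Cases by the smallest key in `T`. With key 0 the complement of `T` has nonnegative sum; with
    -- 1, `T` is `I` plus nonpositive coordinates; with 2, `T` is `I` minus positive ones; otherwise
    -- `T` has only nonpositive coordinates.
    by_cases h0 : ∃ i ∈ T, key i = 0
    · obtain ⟨i, hi, hi0⟩ := h0
      have hc : 0 ≤ ∑ i ∈ Tᶜ, v i := by
        refine Finset.sum_nonneg fun j hj => ?_
        by_contra! hneg
        refine Finset.mem_compl.1 hj (hup i hi j ?_)
        rw [hi0]
        simp [key, hneg.le]
      have := Finset.sum_add_sum_compl T v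
      rw [hv.1] at this
      linarith
    push Not at h0
    by_cases h1 : ∃ i ∈ T, key i = 1
    · obtain ⟨i, hi, hi1⟩ := h1
      have hsub : I ⊆ T := fun j hj => hup i hi j (by rw [hi1]; simp [key, hj]; omega)
      have hc : ∑ i ∈ T \ I, v i ≤ 0 := by
        refine Finset.sum_nonpos fun j hj => ?_
        rw [Finset.mem_sdiff] at hj
        by_contra hneg
        exact h0 j hj.1 (by simp only [key]; rw [if_neg hj.2, if_neg hneg])
      have := Finset.sum_sdiff hsub (f := v)
      linarith
    push Not at h1
    have hsub : T ⊆ I := by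
      intro j hj
      by_contra hjI
      have := h0 j hj
      have := h1 j hj
      by_cases hneg : v j ≤ 0 <;> simp_all [key]
    by_cases h2 : ∃ i ∈ T, key i = 2
    · obtain ⟨i, hi, hi2⟩ := h2
      have hc : 0 ≤ ∑ i ∈ I \ T, v i := by
        refine Finset.sum_nonneg fun j hj => ?_
        rw [Finset.mem_sdiff] at hj
        by_contra! hneg
        exact hj.2 (hup i hi j (by rw [hi2]; simp [key, hj.1, hneg.le]))
      have := Finset.sum_sdiff hsub (f := v)
      linarith
    push Not at h2
    have hc : ∑ i ∈ T, v i ≤ 0 := by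
      refine Finset.sum_nonpos fun j hj => ?_
      by_contra hneg
      exact h2 j hj (by simp only [key]; rw [if_pos (hsub hj), if_neg hneg])
    linarith
  · intro a b hab ha
    simp only [Finset.coe_map, Set.mem_image, Finset.mem_coe, Equiv.coe_toEmbedding] at ha ⊢
    obtain ⟨i, hi, rfl⟩ := ha
    refine ⟨σ b, ?_, by simp⟩
    have := hmono hab
    simp only [Function.comp, Equiv.apply_symm_apply] at this
    by_contra hb
    have h2 : 2 ≤ key i := by simp [key, hi]
    have h3 : key (σ b) < 2 := by
      simp only [key, if_neg hb]
      split_ifs <;> omega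
    omega
  · ext i
    simp [Finset.mem_map_equiv]

/-- A set positive for `w` but negative for `v` is last-placed in some ranking missing from
`weightRankings v`, yet it puts that ranking into `weightRankings w`. -/
theorem SubsetGeneric.weightRankings_eq_iff {v w : Fin m → ℝ} (hv : SubsetGeneric v)
    (hw : SubsetGeneric w) :
    weightRankings v = weightRankings w ↔ positiveSubsets v = positiveSubsets w := by
  constructor
  · intro h
    rw [hv.positiveSubsets_eq_iff hw]
    intro I hI
    by_contra hI'
    have hne : I.Nonempty := by
      rw [Finset.nonempty_iff_ne_empty]
      rintro rfl
      simp [positiveSubsets] at hI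
    have hun : I ≠ Finset.univ := by
      rintro rfl
      simp [positiveSubsets, hw.1] at hI
    obtain ⟨σ, hσ, S, hS, rfl⟩ :=
      hv.exists_notMem_weightRankings ((hv.sum_neg_iff hne hun).2 hI')
    rw [h, mem_weightRankings_iff] at hσ
    exact hσ ⟨S, hS, hI⟩
  · intro h
    ext σ
    rw [mem_weightRankings_iff, mem_weightRankings_iff, h]

end Rankings

/-! ### Unfolding models of codimension one -/

/-- `v` is an affine dependency of the objects `μ`, unique up to scaling, and normalised so that
the squared distances from any point to the objects have positive `v`-weighted sum. -/
structure IsAdapted {m n : ℕ} (v : Fin m → ℝ) (μ : Fin m → EuclideanSpace ℝ (Fin n)) : Prop where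
  sum_eq : ∑ i, v i = 0
  sum_smul : ∑ i, v i • μ i = 0
  pos : 0 < ∑ i, v i * ‖μ i‖ ^ 2
  inj : ∀ (a : ℝ) (y : EuclideanSpace ℝ (Fin n)), (∀ i, a + inner ℝ y (μ i) = 0) → a = 0 ∧ y = 0

theorem dist_sq_eq_expand {E : Type*} [NormedAddCommGroup E] [InnerProductSpace ℝ E] (y z : E) :
    dist y z ^ 2 = ‖y‖ ^ 2 - 2 * inner ℝ y z + ‖z‖ ^ 2 := by
  rw [dist_eq_norm, norm_sub_sq_real]

theorem dist_eq_dist_iff_inner {E : Type*} [NormedAddCommGroup E] [InnerProductSpace ℝ E]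
    (y z w : E) :
    dist y z = dist y w ↔ ‖z‖ ^ 2 - 2 * inner ℝ y z = ‖w‖ ^ 2 - 2 * inner ℝ y w := by
  rw [← sq_eq_sq₀ dist_nonneg dist_nonneg, dist_sq_eq_expand, dist_sq_eq_expand]
  constructor <;> intro h <;> linarith

theorem sum_mul_inner_eq_zero {ι E : Type*} [Fintype ι] [NormedAddCommGroup E]
    [InnerProductSpace ℝ E] {v : ι → ℝ} {μ : ι → E} (h : ∑ i, v i • μ i = 0) (y : E) :
    ∑ i, v i * inner ℝ y (μ i) = 0 := by
  have := congrArg (inner ℝ y) h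
  simpa [inner_sum, inner_smul_right] using this

/-- Dimension count: by `hinj`, affine functions restrict injectively to the objects, giving an `(n
+ 1)`-dimensional space inside the hyperplane orthogonal to `v`, which has the same dimension. -/
theorem exists_eq_add_inner {n : ℕ} {v : Fin (n + 2) → ℝ}
    {μ : Fin (n + 2) → EuclideanSpace ℝ (Fin n)} (hv : v ≠ 0) (h0 : ∑ i, v i = 0)
    (h1 : ∑ i, v i • μ i = 0)
    (hinj : ∀ (a : ℝ) (y : EuclideanSpace ℝ (Fin n)), (∀ i, a + inner ℝ y (μ i) = 0) →
      a = 0 ∧ y = 0)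
    {x : Fin (n + 2) → ℝ} (hx : ∑ i, v i * x i = 0) :
    ∃ (a : ℝ) (y : EuclideanSpace ℝ (Fin n)), ∀ i, x i = a + inner ℝ y (μ i) := by
  let F : ℝ × EuclideanSpace ℝ (Fin n) →ₗ[ℝ] (Fin (n + 2) → ℝ) :=
    { toFun := fun p i => p.1 + inner ℝ p.2 (μ i)
      map_add' := by
        intro p q
        ext i
        simp [inner_add_left]
        ring
      map_smul' := by
        intro c p
        ext i
        simp [inner_smul_left]
        ring }
  let φ : (Fin (n + 2) → ℝ) →ₗ[ℝ] ℝ := Fintype.linearCombination ℝ v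
  have hφ : ∀ x, φ x = ∑ i, v i * x i := by
    intro x
    simp [φ, Fintype.linearCombination_apply, mul_comm]
  have hFinj : Function.Injective F := by
    rw [← LinearMap.ker_eq_bot, LinearMap.ker_eq_bot']
    intro p hp
    obtain ⟨h2, h3⟩ := hinj p.1 p.2 (fun i => congrFun hp i)
    exact Prod.ext h2 h3
  have hle : LinearMap.range F ≤ LinearMap.ker φ := by
    rintro _ ⟨p, rfl⟩
    rw [LinearMap.mem_ker, hφ]
    simp only [F, LinearMap.coe_mk, AddHom.coe_mk, mul_add, Finset.sum_add_distrib]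
    rw [← Finset.sum_mul, h0, sum_mul_inner_eq_zero h1]
    simp
  have hφ0 : φ ≠ 0 := by
    intro h
    apply hv
    ext i
    have := hφ (Pi.single i 1)
    rw [h] at this
    simpa [Pi.single_apply] using this.symm
  have hker := Module.Dual.finrank_ker_add_one_of_ne_zero (f := φ) hφ0
  have hrange := LinearMap.finrank_range_of_inj hFinj
  rw [Module.finrank_prod, Module.finrank_self, finrank_euclideanSpace_fin] at hrange
  rw [Module.finrank_fin_fun] at hker
  have heq := Submodule.eq_of_le_of_finrank_eq hle (by omega)
  have : x ∈ LinearMap.ker φ := by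
    rw [LinearMap.mem_ker, hφ, hx]
  rw [← heq] at this
  obtain ⟨p, hp⟩ := this
  exact ⟨p.1, p.2, fun i => (congrFun hp i).symm⟩

namespace IsAdapted

/-- In the expanded squares, the terms in `‖y‖ ^ 2` and in `y` are killed by the two dependency
relations. -/
theorem sum_mul_dist_sq {m n : ℕ} {v : Fin m → ℝ} {μ : Fin m → EuclideanSpace ℝ (Fin n)}
    (h : IsAdapted v μ) (y : EuclideanSpace ℝ (Fin n)) :
    ∑ i, v i * dist y (μ i) ^ 2 = ∑ i, v i * ‖μ i‖ ^ 2 := by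
  have h1 : ∀ i, v i * dist y (μ i) ^ 2 =
      v i * ‖y‖ ^ 2 - 2 * (v i * inner ℝ y (μ i)) + v i * ‖μ i‖ ^ 2 := by
    intro i
    rw [dist_sq_eq_expand]
    ring
  simp only [h1, Finset.sum_add_distrib, Finset.sum_sub_distrib]
  rw [← Finset.sum_mul, h.sum_eq, ← Finset.mul_sum, sum_mul_inner_eq_zero h.sum_smul]
  ring

theorem ne_zero {m n : ℕ} {v : Fin m → ℝ} {μ : Fin m → EuclideanSpace ℝ (Fin n)}
    (h : IsAdapted v μ) : v ≠ 0 := by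
  rintro rfl
  simpa using h.pos

/-- At `y = μ p` the `p`-th term of the positive sum vanishes, so another weight must be positive.
-/
theorem exists_two_pos {m n : ℕ} {v : Fin m → ℝ} {μ : Fin m → EuclideanSpace ℝ (Fin n)}
    (h : IsAdapted v μ) : ∃ p q, p ≠ q ∧ 0 < v p ∧ 0 < v q := by
  have key : ∀ y, ∃ q, 0 < v q ∧ y ≠ μ q := by
    intro y
    have h1 := h.pos
    rw [← h.sum_mul_dist_sq y] at h1
    obtain ⟨q, -, hq⟩ := Finset.exists_lt_of_sum_lt (f := fun _ => (0 : ℝ)) (by simpa using h1)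
    refine ⟨q, ?_, ?_⟩
    · by_contra! hle
      exact absurd hq (not_lt.2 (mul_nonpos_of_nonpos_of_nonneg hle (sq_nonneg _)))
    · rintro rfl
      simp at hq
  obtain ⟨p, hp, -⟩ := key 0
  obtain ⟨q, hq, hpq⟩ := key (μ p)
  exact ⟨p, q, fun e => hpq (by rw [e]), hp, hq⟩

variable {n : ℕ} {v : Fin (n + 2) → ℝ} {μ : Fin (n + 2) → EuclideanSpace ℝ (Fin n)}

theorem exists_dist_sq_eq (h : IsAdapted v μ) {x : Fin (n + 2) → ℝ}
    (hx : ∑ i, v i * x i = ∑ i, v i * ‖μ i‖ ^ 2) :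
    ∃ (y : EuclideanSpace ℝ (Fin n)) (a : ℝ), ∀ i, dist y (μ i) ^ 2 = x i + a := by
  obtain ⟨a, y, hy⟩ := exists_eq_add_inner h.ne_zero h.sum_eq h.sum_smul h.inj
    (x := fun i => x i - ‖μ i‖ ^ 2) (by simp only [mul_sub, Finset.sum_sub_distrib, hx, sub_self])
  -- The factor `-1/2` offsets the `-2` in the expansion of the squared distance.
  refine ⟨(-(1 / 2) : ℝ) • y, ‖(-(1 / 2) : ℝ) • y‖ ^ 2 - a, fun i => ?_⟩
  rw [dist_sq_eq_expand, real_inner_smul_left]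
  linarith [hy i]

end IsAdapted

/-- If a weight of total zero has positive correlation with a monotone function, then it is
positive on some upper set. -/
theorem exists_isUpperSet_sum_pos {m : ℕ} {w g : Fin m → ℝ} (hw : ∑ j, w j = 0) (hg : Monotone g)
    (h : 0 < ∑ j, w j * g j) :
    ∃ S : Finset (Fin m), IsUpperSet (S : Set (Fin m)) ∧ 0 < ∑ j ∈ S, w j := by
  obtain _ | k := m
  · simp at h
  by_contra! hS
  let G : ℕ → ℝ := fun i => g ⟨min i k, by omega⟩
  have hG : Monotone G := fun a b hab => hg (by
    rw [Fin.mk_le_mk]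
    omega)
  -- Abel summation: `g` is a constant plus nonnegative multiples of indicators of the upper sets
  -- `{j | i < j}`.
  have h1 : ∀ j : Fin (k + 1), w j * g j = w j * g 0 +
      ∑ i ∈ Finset.range (k + 1), if i < (j : ℕ) then w j * (G (i + 1) - G i) else 0 := by
    intro j
    have h2 : ∑ i ∈ Finset.range j, (G (i + 1) - G i) = g j - g 0 := by
      rw [Finset.sum_range_sub]
      have e1 : G j = g j := congrArg g (Fin.ext (by simp; omega))
      have e2 : G 0 = g 0 := congrArg g (Fin.ext (by simp))
      rw [e1, e2]
    rw [← Finset.sum_filter, ← Finset.mul_sum]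
    have h3 : (Finset.range (k + 1)).filter (fun i => i < (j : ℕ)) = Finset.range j := by
      ext i
      simp only [Finset.mem_filter, Finset.mem_range]
      omega
    rw [h3, h2]
    ring
  rw [Finset.sum_congr rfl fun j _ => h1 j, Finset.sum_add_distrib, ← Finset.sum_mul, hw,
    Finset.sum_comm] at h
  refine absurd h (not_lt.2 ?_)
  rw [zero_mul, zero_add]
  refine Finset.sum_nonpos fun i _ => ?_
  rw [← Finset.sum_filter, ← Finset.sum_mul]
  refine mul_nonpos_of_nonpos_of_nonneg (hS _ ?_) (sub_nonneg.2 (hG (Nat.le_succ i)))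
  intro a b hab ha
  simp only [Finset.coe_filter, Finset.mem_univ, true_and, Set.mem_ofPred_eq] at ha ⊢
  exact lt_of_lt_of_le ha hab

/-- Squared distances along a ranking are increasing and have positive weighted sum, so some upper
set has positive weight. Conversely, a large jump on such an upper set, plus a small slope for
strictness, gives admissible squared distances. -/
theorem IsAdapted.rankingPattern_eq {n : ℕ} {v : Fin (n + 2) → ℝ}
    {μ : Fin (n + 2) → EuclideanSpace ℝ (Fin n)} (h : IsAdapted v μ) :
    rankingPattern μ = weightRankings v := by
  classical
  ext σ
  have hσ0 : ∑ j, v (σ j) = 0 := by rw [Equiv.sum_comp σ v, h.sum_eq]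
  constructor
  · rintro ⟨y, hy⟩
    refine exists_isUpperSet_sum_pos (g := fun j => dist y (μ (σ j)) ^ 2) hσ0 ?_ ?_
    · intro a b hab
      exact pow_le_pow_left₀ dist_nonneg (hy.monotone hab) 2
    · rw [Equiv.sum_comp σ fun i => v i * dist y (μ i) ^ 2, h.sum_mul_dist_sq]
      exact h.pos
  · rintro ⟨S, hS, hpos⟩
    set c := ∑ i, v i * ‖μ i‖ ^ 2 with hc
    have hc0 : 0 < c := h.pos
    set T := ∑ j ∈ S, v (σ j)
    set b := ∑ j, v (σ j) * (j : ℝ)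
    -- The slope is small enough that `ε * b < c`; then `t` solves `ε * b + t * T = c`.
    set ε := c / (|b| + 1)
    have hε : 0 < ε := by positivity
    have hεb : ε * b < c := by
      have h1 : ε * (|b| + 1) = c := div_mul_cancel₀ _ (by positivity)
      have h2 : ε * b ≤ ε * |b| := mul_le_mul_of_nonneg_left (le_abs_self b) hε.le
      linarith
    set t := (c - ε * b) / T
    have ht : 0 < t := div_pos (sub_pos.2 hεb) hpos
    let x : Fin (n + 2) → ℝ := fun j => ε * (j : ℝ) + if j ∈ S then t else 0
    have hx : StrictMono x := by
      intro i j hij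
      have h1 : ε * (i : ℝ) < ε * (j : ℝ) :=
        mul_lt_mul_of_pos_left (by exact_mod_cast hij) hε
      have h2 : (if i ∈ S then t else 0) ≤ if j ∈ S then t else 0 := by
        by_cases hi : i ∈ S
        · rw [if_pos hi, if_pos (Finset.mem_coe.1 (hS hij.le hi))]
        · rw [if_neg hi]
          split_ifs
          exacts [ht.le, le_rfl]
      exact add_lt_add_of_lt_of_le h1 h2
    obtain ⟨y, a, hy⟩ := h.exists_dist_sq_eq (x := x ∘ σ.symm) (by
      rw [← Equiv.sum_comp σ]
      simp only [Function.comp, Equiv.symm_apply_apply, x, mul_add, Finset.sum_add_distrib,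
        mul_ite, mul_zero]
      rw [← Finset.sum_filter, Finset.filter_univ_mem, ← Finset.sum_mul]
      have h1 : ∑ j, v (σ j) * (ε * (j : ℝ)) = ε * b := by
        rw [Finset.mul_sum]
        exact Finset.sum_congr rfl fun j _ => by ring
      rw [h1, mul_div_cancel₀ _ hpos.ne']
      ring)
    refine ⟨y, fun i j hij => ?_⟩
    have h1 := hx hij
    have hi := hy (σ i)
    have hj := hy (σ j)
    simp only [Function.comp, Equiv.symm_apply_apply] at hi hj
    exact lt_of_pow_lt_pow_left₀ 2 dist_nonneg (by linarith)

/-! ### Generic objects and generic weights -/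

/-- The direction of the flats of points equidistant from the objects of each class. -/
def equidistantDirection {m n : ℕ} (μ : Fin m → EuclideanSpace ℝ (Fin n)) (r : Setoid (Fin m)) :
    Submodule ℝ (EuclideanSpace ℝ (Fin n)) where
  carrier := {w | ∀ i j, r i j → inner ℝ w (μ i) = inner ℝ w (μ j)}
  zero_mem' := by simp
  add_mem' := by
    intro a b ha hb i j hij
    rw [inner_add_left, inner_add_left, ha i j hij, hb i j hij]
  smul_mem' := by
    intro c a ha i j hij
    rw [real_inner_smul_left, real_inner_smul_left, ha i j hij]

theorem vectorSpan_equidistantSet {m n : ℕ} {μ : Fin m → EuclideanSpace ℝ (Fin n)}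
    {r : Setoid (Fin m)} (h : (equidistantSet μ r).Nonempty) :
    vectorSpan ℝ (equidistantSet μ r) = equidistantDirection μ r := by
  obtain ⟨y, hy⟩ := h
  have : equidistantSet μ r = (AffineSubspace.mk' y (equidistantDirection μ r) :
      Set (EuclideanSpace ℝ (Fin n))) := by
    ext z
    rw [SetLike.mem_coe, AffineSubspace.mem_mk', vsub_eq_sub]
    refine forall_congr' fun i => forall_congr' fun j => forall_congr' fun hij => ?_
    have := hy i j hij
    rw [dist_eq_dist_iff_inner] at this ⊢
    rw [inner_sub_left, inner_sub_left]
    constructor <;> intro h <;> linarith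
  rw [this, ← AffineSubspace.direction_eq_vectorSpan, AffineSubspace.direction_mk']

theorem SubsetGeneric.sum_mul_comp_mk_ne_zero {m : ℕ} {v : Fin m → ℝ} (hv : SubsetGeneric v)
    (r : Setoid (Fin m)) [Fintype (Quotient r)] [DecidableEq (Quotient r)]
    (hr : 1 < Nat.card (Quotient r)) (q : Quotient r) :
    ∑ i, v i * (Pi.single q 1 : Quotient r → ℝ) (Quotient.mk r i) ≠ 0 := by
  simp only [Pi.single_apply, mul_ite, mul_one, mul_zero]
  rw [← Finset.sum_filter]
  refine hv.2 _ ?_ ?_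
  · induction q using Quotient.inductionOn with
    | h i => exact ⟨i, by simp⟩
  · rw [Nat.card_eq_fintype_card, Fintype.one_lt_card_iff_nontrivial] at hr
    obtain ⟨q', hq'⟩ := exists_ne q
    induction q' using Quotient.inductionOn with
    | h i =>
      intro h
      have : i ∈ Finset.univ.filter fun i => Quotient.mk r i = q := by rw [h]; simp
      simp only [Finset.mem_filter, Finset.mem_univ, true_and] at this
      exact hq' this

/-- Squared distances constant on blocks correspond to block vectors `z` with `ψ z = c`. For `k ≥ 2`
blocks `ψ` is nonzero, and discarding the additive constant leaves dimension `k - 2`; for one block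
the weighted sum is `0 ≠ c`. -/
theorem IsAdapted.isGenericUnfolding {n : ℕ} {v : Fin (n + 2) → ℝ}
    {μ : Fin (n + 2) → EuclideanSpace ℝ (Fin n)} (h : IsAdapted v μ) (hv : SubsetGeneric v) :
    IsGenericUnfolding μ := by
  classical
  intro r
  have : Fintype (Quotient r) := Fintype.ofFinite _
  constructor
  · intro hr
    have hr2 : 1 < Nat.card (Quotient r) := by omega
    let ψ : (Quotient r → ℝ) →ₗ[ℝ] ℝ :=
      { toFun := fun z => ∑ i, v i * z (Quotient.mk r i)
        map_add' := by
          intro z z'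
          simp [mul_add, Finset.sum_add_distrib]
        map_smul' := by
          intro c z
          simp only [Pi.smul_apply, smul_eq_mul, RingHom.id_apply, Finset.mul_sum]
          exact Finset.sum_congr rfl fun i _ => by ring }
    have hψ : ∀ q, ψ (Pi.single q 1) ≠ 0 := hv.sum_mul_comp_mk_ne_zero r hr2
    let q₀ : Quotient r := Quotient.mk r 0
    have hψ0 : ψ ≠ 0 := fun h0 => hψ q₀ (by rw [h0]; rfl)
    have hne : (equidistantSet μ r).Nonempty := by
      let z : Quotient r → ℝ :=
        ((∑ i, v i * ‖μ i‖ ^ 2) / ψ (Pi.single q₀ 1)) • (Pi.single q₀ 1 : Quotient r → ℝ)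
      have hz : ψ z = ∑ i, v i * ‖μ i‖ ^ 2 := by
        rw [map_smul, smul_eq_mul, div_mul_cancel₀ _ (hψ q₀)]
      obtain ⟨y, a, hy⟩ := h.exists_dist_sq_eq (x := fun i => z (Quotient.mk r i)) hz
      refine ⟨y, fun i j hij => ?_⟩
      rw [← sq_eq_sq₀ dist_nonneg dist_nonneg, hy, hy, Quotient.sound hij]
    refine ⟨hne, ?_⟩
    rw [vectorSpan_equidistantSet hne]
    let G : ℝ × equidistantDirection μ r →ₗ[ℝ] (Quotient r → ℝ) :=
      { toFun := fun p q => p.1 + inner ℝ (p.2 : EuclideanSpace ℝ (Fin n)) (μ q.out)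
        map_add' := by
          intro p q
          ext i
          simp [inner_add_left]
          ring
        map_smul' := by
          intro c p
          ext i
          simp [inner_smul_left]
          ring }
    have hG : ∀ p i, G p (Quotient.mk r i) =
        p.1 + inner ℝ (p.2 : EuclideanSpace ℝ (Fin n)) (μ i) := fun p i =>
      congrArg (p.1 + ·) (p.2.2 _ _ (Quotient.mk_out (s := r) i))
    have hGinj : Function.Injective G := by
      rw [← LinearMap.ker_eq_bot, LinearMap.ker_eq_bot']
      intro p hp
      obtain ⟨h2, h3⟩ := h.inj p.1 p.2 (fun i => by rw [← hG, hp]; rfl)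
      exact Prod.ext h2 (Subtype.ext h3)
    have hrange : LinearMap.range G = LinearMap.ker ψ := by
      ext z
      rw [LinearMap.mem_ker]
      constructor
      · rintro ⟨p, rfl⟩
        change ∑ i, v i * G p (Quotient.mk r i) = 0
        simp only [hG, mul_add, Finset.sum_add_distrib]
        rw [← Finset.sum_mul, h.sum_eq, sum_mul_inner_eq_zero h.sum_smul]
        simp
      · intro hz
        obtain ⟨a, y, hy⟩ := exists_eq_add_inner h.ne_zero h.sum_eq h.sum_smul h.inj
          (x := fun i => z (Quotient.mk r i)) hz
        refine ⟨⟨a, y, fun i j hij => ?_⟩, ?_⟩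
        · have hi := hy i
          have hj := hy j
          simp only [Quotient.sound hij] at hi hj
          linarith
        · ext q
          induction q using Quotient.inductionOn with
          | h i => rw [hG, hy]
    have h1 := LinearMap.finrank_range_of_inj hGinj
    have h2 := Module.Dual.finrank_ker_add_one_of_ne_zero (f := ψ) hψ0
    rw [hrange, Module.finrank_prod, Module.finrank_self] at h1
    rw [Module.finrank_fintype_fun_eq_card, ← Nat.card_eq_fintype_card] at h2
    change Module.finrank ℝ (LinearMap.ker ψ) + 1 = _ at h2
    omega
  · intro hr
    have hr1 : Nat.card (Quotient r) ≤ 1 := by omega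
    rw [Finite.card_le_one_iff_subsingleton] at hr1
    rw [Set.eq_empty_iff_forall_notMem]
    intro y hy
    have h1 := h.pos
    rw [← h.sum_mul_dist_sq y] at h1
    have h2 : ∀ i, dist y (μ i) = dist y (μ 0) := fun i =>
      hy i 0 (Quotient.exact (Subsingleton.elim _ _))
    simp only [h2] at h1
    rw [← Finset.sum_mul, h.sum_eq, zero_mul] at h1
    exact lt_irrefl _ h1

/-- Only partitions into one or two blocks are needed: one block gives `c ≠ 0`; two blocks give
affine spanning and nonvanishing subset sums. -/
theorem IsGenericUnfolding.exists_isAdapted {n : ℕ}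
    {μ : Fin (n + 2) → EuclideanSpace ℝ (Fin n)} (hμ : IsGenericUnfolding μ) :
    ∃ v, SubsetGeneric v ∧ IsAdapted v μ := by
  classical
  have hpart : ∀ I : Finset (Fin (n + 2)), I.Nonempty → I ≠ Finset.univ →
      (∃ y, ∀ i j, (i ∈ I ↔ j ∈ I) → dist y (μ i) = dist y (μ j)) ∧
      ∀ w : EuclideanSpace ℝ (Fin n),
        (∀ i j, (i ∈ I ↔ j ∈ I) → inner ℝ w (μ i) = inner ℝ w (μ j)) → w = 0 := by
    intro I hI hI'
    have hsurj : Function.Surjective fun i => decide (i ∈ I) := by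
      intro b
      cases b
      · obtain ⟨i, hi⟩ : ∃ i, i ∉ I := by
          by_contra! h
          exact hI' (Finset.eq_univ_iff_forall.2 h)
        exact ⟨i, by simpa using hi⟩
      · obtain ⟨i, hi⟩ := hI
        exact ⟨i, by simpa using hi⟩
    have hcard : Nat.card (Quotient (Setoid.ker fun i => decide (i ∈ I))) = 2 := by
      rw [Nat.card_congr (Setoid.quotientKerEquivOfSurjective _ hsurj)]
      simp
    have hr : ∀ i j, Setoid.ker (fun i => decide (i ∈ I)) i j ↔ (i ∈ I ↔ j ∈ I) := by
      intro i j
      rw [Setoid.ker_def]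
      simp
    obtain ⟨hne, hdim⟩ := (hμ (Setoid.ker fun i => decide (i ∈ I))).1 (by omega)
    rw [vectorSpan_equidistantSet hne, hcard] at hdim
    have hbot : equidistantDirection μ (Setoid.ker fun i => decide (i ∈ I)) = ⊥ := by
      rw [← Submodule.finrank_eq_zero (R := ℝ)]
      omega
    obtain ⟨y, hy⟩ := hne
    refine ⟨⟨y, fun i j hij => hy i j ((hr i j).2 hij)⟩, fun w hw => ?_⟩
    rw [← Submodule.mem_bot ℝ, ← hbot]
    exact fun i j hij => hw i j ((hr i j).1 hij)
  have hempty : ∀ y, ¬ ∀ i j, dist y (μ i) = dist y (μ j) := by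
    intro y hy
    have hcard : Nat.card (Quotient (⊤ : Setoid (Fin (n + 2)))) ≤ 1 := by
      rw [Finite.card_le_one_iff_subsingleton]
      exact ⟨fun a b => Quotient.inductionOn₂ a b fun i j => Quotient.sound trivial⟩
    have := (hμ ⊤).2 (by omega)
    rw [Set.eq_empty_iff_forall_notMem] at this
    exact this y fun i j _ => hy i j
  have hinj : ∀ (a : ℝ) (y : EuclideanSpace ℝ (Fin n)), (∀ i, a + inner ℝ y (μ i) = 0) →
      a = 0 ∧ y = 0 := by
    intro a y hay
    have hy : y = 0 := by
      refine (hpart {0} (by simp) ?_).2 y fun i j _ => ?_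
      · intro h
        have := Finset.mem_univ (1 : Fin (n + 2))
        rw [← h] at this
        simp at this
      · linarith [hay i, hay j]
    refine ⟨?_, hy⟩
    have := hay 0
    rw [hy] at this
    simpa using this
  obtain ⟨v, hv0, hsum, hsmul⟩ : ∃ v : Fin (n + 2) → ℝ, v ≠ 0 ∧ ∑ i, v i = 0 ∧
      ∑ i, v i • μ i = 0 := by
    let Λ : (Fin (n + 2) → ℝ) →ₗ[ℝ] ℝ × EuclideanSpace ℝ (Fin n) :=
      Fintype.linearCombination ℝ fun i => ((1 : ℝ), μ i)
    have hΛ : LinearMap.ker Λ ≠ ⊥ := LinearMap.ker_ne_bot_of_finrank_lt (by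
      rw [Module.finrank_prod, Module.finrank_self, finrank_euclideanSpace_fin,
        Module.finrank_fin_fun]
      omega)
    obtain ⟨v, hv, hv0⟩ := Submodule.exists_mem_ne_zero_of_ne_bot hΛ
    rw [LinearMap.mem_ker, Fintype.linearCombination_apply] at hv
    refine ⟨v, hv0, ?_, ?_⟩
    · simpa [Prod.fst_sum] using congrArg Prod.fst hv
    · simpa [Prod.snd_sum] using congrArg Prod.snd hv
  have hc : ∑ i, v i * ‖μ i‖ ^ 2 ≠ 0 := by
    intro hc
    -- If `c = 0`, then `‖μ i‖ ^ 2` is affine in `μ i`, and half its gradient is equidistant from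
    -- all objects.
    obtain ⟨a, y, hy⟩ := exists_eq_add_inner hv0 hsum hsmul hinj hc
    refine hempty ((1 / 2 : ℝ) • y) fun i j => ?_
    rw [dist_eq_dist_iff_inner, real_inner_smul_left, real_inner_smul_left]
    linarith [hy i, hy j]
  obtain ⟨u, hu⟩ : ∃ u, IsAdapted u μ := by
    rcases lt_or_gt_of_ne hc with h | h
    · exact ⟨-v, by simp [hsum], by simp [hsmul], by simpa using h, hinj⟩
    · exact ⟨v, hsum, hsmul, h, hinj⟩
  refine ⟨u, ⟨hu.sum_eq, fun I hI hI' h0 => ?_⟩, hu⟩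
  -- At a point equidistant within `I` and within `Iᶜ`, vanishing of both block sums would make the
  -- weighted sum zero.
  obtain ⟨y, hy⟩ := (hpart I hI hI').1
  obtain ⟨i₀, hi₀⟩ := hI
  obtain ⟨j₀, hj₀⟩ : ∃ i, i ∉ I := by
    by_contra! h
    exact hI' (Finset.eq_univ_iff_forall.2 h)
  have h1 := hu.pos
  rw [← hu.sum_mul_dist_sq y, ← Finset.sum_add_sum_compl I] at h1
  have h2 : ∑ i ∈ I, u i * dist y (μ i) ^ 2 = ∑ i ∈ I, u i * dist y (μ i₀) ^ 2 :=
    Finset.sum_congr rfl fun i hi => by rw [hy i i₀ (by simp [hi, hi₀])]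
  have h3 : ∑ i ∈ Iᶜ, u i * dist y (μ i) ^ 2 = ∑ i ∈ Iᶜ, u i * dist y (μ j₀) ^ 2 :=
    Finset.sum_congr rfl fun i hi => by
      rw [hy i j₀ (by simp [Finset.mem_compl.1 hi, hj₀])]
  have h4 := Finset.sum_add_sum_compl I u
  rw [hu.sum_eq, h0, zero_add] at h4
  rw [h2, h3, ← Finset.sum_mul, ← Finset.sum_mul, h0, h4] at h1
  simp at h1

/-- Any spanning configuration `ν` with dependency `v` is stretched by `z ↦ z + t⟪a, z⟫a`. This
keeps the dependency and adds a positive multiple of `Q = ∑ v i * ⟪a, ν i⟫ ^ 2` to `c`; two positive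
weights allow `Q > 0`. -/
theorem exists_isAdapted_of_two_pos {n : ℕ} {v : Fin (n + 2) → ℝ} (hv : SubsetGeneric v)
    {p q : Fin (n + 2)} (hpq : p ≠ q) (hp : 0 < v p) (hq : 0 < v q) :
    ∃ μ : Fin (n + 2) → EuclideanSpace ℝ (Fin n), IsAdapted v μ := by
  classical
  have hlast : v (Fin.last (n + 1)) ≠ 0 := by
    have := hv.2 {Fin.last (n + 1)} (by simp) (fun h => by
      have := Finset.mem_univ (0 : Fin (n + 2))
      rw [← h] at this
      simp [Fin.ext_iff] at this)
    simpa using this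
  let e : Fin n → EuclideanSpace ℝ (Fin n) := fun j => EuclideanSpace.single j 1
  let ν : Fin (n + 2) → EuclideanSpace ℝ (Fin n) :=
    Fin.snoc (α := fun _ => EuclideanSpace ℝ (Fin n)) (Fin.cons 0 e)
      (-(v (Fin.last (n + 1)))⁻¹ • ∑ j : Fin n, v j.succ.castSucc • e j)
  have hν0 : ν 0 = 0 := by
    have : (0 : Fin (n + 2)) = Fin.castSucc 0 := rfl
    rw [this]
    simp only [ν, Fin.snoc_castSucc, Fin.cons_zero]
  have hν1 : ∀ j : Fin n, ν j.succ.castSucc = e j := by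
    intro j
    simp only [ν, Fin.snoc_castSucc, Fin.cons_succ]
  have hν2 : ν (Fin.last (n + 1)) =
      -(v (Fin.last (n + 1)))⁻¹ • ∑ j : Fin n, v j.succ.castSucc • e j := by
    simp only [ν, Fin.snoc_last]
  have hνsum : ∑ i, v i • ν i = 0 := by
    rw [Fin.sum_univ_castSucc, Fin.sum_univ_succ, Fin.castSucc_zero, hν0, hν2]
    simp only [hν1, neg_smul, smul_neg, smul_smul, mul_inv_cancel₀ hlast]
    simp
  have hνinj : ∀ (a : ℝ) (y : EuclideanSpace ℝ (Fin n)), (∀ i, a + inner ℝ y (ν i) = 0) →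
      a = 0 ∧ y = 0 := by
    intro a y h
    have ha : a = 0 := by simpa [hν0] using h 0
    refine ⟨ha, ?_⟩
    ext j
    have := h j.succ.castSucc
    rw [hν1, ha] at this
    simpa [e, EuclideanSpace.inner_single_right] using this
  have hvne : v ≠ 0 := by
    rintro rfl
    simp at hp
  -- Orthogonal to `v` and supported where `v` is positive; `a` is its gradient as an affine
  -- function, and the constant part does not affect the quadratic sum.
  let w : Fin (n + 2) → ℝ := Pi.single p (v q) - Pi.single q (v p)
  have hw1 : ∑ i, v i * w i = 0 := by
    simp only [w, Pi.sub_apply, mul_sub, Finset.sum_sub_distrib, Pi.single_apply, mul_ite,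
      mul_zero, Finset.sum_ite_eq', Finset.mem_univ, if_true]
    ring
  have hw2 : 0 < ∑ i, v i * w i ^ 2 := by
    rw [← Finset.sum_subset (Finset.subset_univ {p, q})]
    · rw [Finset.sum_pair hpq]
      simp only [w, Pi.sub_apply, Pi.single_apply, if_neg hpq, if_neg hpq.symm, if_true]
      have : 0 < v p * v q := mul_pos hp hq
      nlinarith [mul_pos this hq, mul_pos this hp]
    · intro i _ hi
      simp only [Finset.mem_insert, Finset.mem_singleton, not_or] at hi
      simp [w, hi.1, hi.2]
  obtain ⟨b, a, hwa⟩ := exists_eq_add_inner hvne hv.1 hνsum hνinj hw1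
  have hQ : 0 < ∑ i, v i * inner ℝ a (ν i) ^ 2 := by
    have h1 : ∀ i, v i * inner ℝ a (ν i) ^ 2 =
        v i * w i ^ 2 - 2 * b * (v i * w i) + b ^ 2 * v i := by
      intro i
      rw [hwa]
      ring
    simp only [h1, Finset.sum_add_distrib, Finset.sum_sub_distrib, ← Finset.mul_sum, hw1, hv.1]
    linarith
  set Q := ∑ i, v i * inner ℝ a (ν i) ^ 2 with hQdef
  set c := ∑ i, v i * ‖ν i‖ ^ 2 with hcdef
  set t : ℝ := (|c| + 1) / Q with htdef
  have ht : 0 < t := by positivity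
  refine ⟨fun i => ν i + (t * inner ℝ a (ν i)) • a, hv.1, ?_, ?_, ?_⟩
  · have h1 : ∀ i, v i • (ν i + (t * inner ℝ a (ν i)) • a) =
        v i • ν i + (t * (v i * inner ℝ a (ν i))) • a := by
      intro i
      rw [smul_add, smul_smul]
      congr 2
      ring
    simp only [h1, Finset.sum_add_distrib, hνsum]
    rw [← Finset.sum_smul, ← Finset.mul_sum, sum_mul_inner_eq_zero hνsum]
    simp
  · have h1 : ∀ i, v i * ‖ν i + (t * inner ℝ a (ν i)) • a‖ ^ 2 =
        v i * ‖ν i‖ ^ 2 + (2 * t + t ^ 2 * ‖a‖ ^ 2) * (v i * inner ℝ a (ν i) ^ 2) := by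
      intro i
      rw [norm_add_sq_real, real_inner_smul_right, norm_smul, mul_pow, Real.norm_eq_abs, sq_abs,
        real_inner_comm]
      ring
    simp only [h1, Finset.sum_add_distrib, ← Finset.mul_sum]
    rw [← hQdef, ← hcdef]
    have h2 : t * Q = |c| + 1 := div_mul_cancel₀ _ hQ.ne'
    have h3 : 0 ≤ t ^ 2 * ‖a‖ ^ 2 * Q := by positivity
    have h4 := neg_abs_le c
    have h5 := abs_nonneg c
    nlinarith
  · intro a₀ y h
    -- The stretching map is self-adjoint, so it moves over to `y`; it is also injective.
    have h1 : ∀ i, a₀ + inner ℝ (y + (t * inner ℝ y a) • a) (ν i) = 0 := by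
      intro i
      rw [← h i, inner_add_left, inner_add_right, real_inner_smul_left, real_inner_smul_right]
      ring
    obtain ⟨h2, h3⟩ := hνinj _ _ h1
    refine ⟨h2, ?_⟩
    have h4 := congrArg (fun z => inner ℝ z a) h3
    simp only [inner_add_left, real_inner_smul_left, inner_zero_left,
      real_inner_self_eq_norm_sq] at h4
    have h5 : inner ℝ y a * (1 + t * ‖a‖ ^ 2) = 0 := by linarith
    have h6 : inner ℝ y a = 0 := by
      rcases mul_eq_zero.1 h5 with h6 | h6
      · exact h6
      · have : 0 ≤ t * ‖a‖ ^ 2 := by positivity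
        linarith
    rw [h6] at h3
    simpa using h3

/-! ### Counting -/

theorem natCard_eq_of_surjective {α β γ : Type*} {f : α → β} {g : α → γ}
    (hf : Function.Surjective f) (hg : Function.Surjective g)
    (h : ∀ a b, f a = f b ↔ g a = g b) : Nat.card β = Nat.card γ := by
  have : Setoid.ker f = Setoid.ker g := Setoid.ext fun a b => h a b
  rw [← Nat.card_congr (Setoid.quotientKerEquivOfSurjective f hf), this,
    Nat.card_congr (Setoid.quotientKerEquivOfSurjective g hg)]

/-- The sign patterns of the generic weights with increasing coordinates. -/
def increasingPatterns (m : ℕ) : Set (Set (Finset (Fin m))) :=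
  {P | ∃ v : Fin m → ℝ, SubsetGeneric v ∧ StrictMono v ∧ positiveSubsets v = P}

/-- The sign pattern of an increasing weight whose only positive coordinate is the last one. -/
def lastPattern (n : ℕ) : Set (Finset (Fin (n + 2))) :=
  {I | Fin.last (n + 1) ∈ I ∧ I ≠ Finset.univ}

/-! ### Equivalence classes as increasing sign patterns -/

section Classes

variable {n : ℕ} {v : Fin (n + 2) → ℝ}

theorem singleton_mem_positiveSubsets {i : Fin (n + 2)} : {i} ∈ positiveSubsets v ↔ 0 < v i := by
  simp [positiveSubsets]

theorem sum_pos_iff_of_neg (h0 : ∑ i, v i = 0) (hneg : ∀ i, i ≠ Fin.last (n + 1) → v i < 0)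
    {I : Finset (Fin (n + 2))} (hI : I.Nonempty) (hI' : I ≠ Finset.univ) :
    (Fin.last (n + 1) ∈ I → 0 < ∑ i ∈ I, v i) ∧ (Fin.last (n + 1) ∉ I → ∑ i ∈ I, v i < 0) := by
  classical
  constructor
  · intro hl
    have h1 : ∑ i ∈ Iᶜ, v i < 0 := by
      refine Finset.sum_neg (fun i hi => hneg i ?_) ?_
      · rintro rfl
        exact Finset.mem_compl.1 hi hl
      · rw [Finset.nonempty_iff_ne_empty]
        simpa using hI'
    have := Finset.sum_add_sum_compl I v
    linarith
  · intro hl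
    refine Finset.sum_neg (fun i hi => hneg i ?_) hI
    rintro rfl
    exact hl hi

theorem positiveSubsets_eq_lastPattern (h0 : ∑ i, v i = 0)
    (hneg : ∀ i, i ≠ Fin.last (n + 1) → v i < 0) : positiveSubsets v = lastPattern n := by
  ext I
  by_cases hI' : I = Finset.univ
  · simp [hI', positiveSubsets, lastPattern, h0]
  rcases I.eq_empty_or_nonempty with rfl | hI
  · simp [positiveSubsets, lastPattern]
  have h := sum_pos_iff_of_neg h0 hneg hI hI'
  by_cases hl : Fin.last (n + 1) ∈ I
  · simp [positiveSubsets, lastPattern, hl, hI', h.1 hl]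
  · simp [positiveSubsets, lastPattern, hl, (h.2 hl).le]

theorem lastPattern_mem_increasingPatterns (n : ℕ) : lastPattern n ∈ increasingPatterns (n + 2) := by
  -- The amount added to the last coordinate to bring the total to zero.
  let K : ℝ := ∑ i : Fin (n + 2), ((n : ℝ) + 1 - i)
  let v : Fin (n + 2) → ℝ := fun i => (i : ℝ) - (n + 1) + if i = Fin.last (n + 1) then K else 0
  have hle : ∀ i : Fin (n + 2), (i : ℝ) ≤ n + 1 := fun i => by exact_mod_cast Fin.le_last i
  have hK : 0 ≤ K := Finset.sum_nonneg fun i _ => sub_nonneg.2 (hle i)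
  have h0 : ∑ i, v i = 0 := by
    simp only [v, K, Finset.sum_add_distrib, Finset.sum_sub_distrib, Finset.sum_ite_eq',
      Finset.mem_univ, if_true]
    ring
  have hneg : ∀ i, i ≠ Fin.last (n + 1) → v i < 0 := by
    intro i hi
    have : (i : ℝ) < n + 1 := by exact_mod_cast Fin.lt_last_iff_ne_last.2 hi
    simp only [v, if_neg hi]
    linarith
  refine ⟨v, ⟨h0, fun I hI hI' => ?_⟩, ?_, positiveSubsets_eq_lastPattern h0 hneg⟩
  · have h := sum_pos_iff_of_neg h0 hneg hI hI'
    by_cases hl : Fin.last (n + 1) ∈ I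
    · exact (h.1 hl).ne'
    · exact (h.2 hl).ne
  · intro i j hij
    have h1 : (i : ℝ) < j := by exact_mod_cast hij
    simp only [v, if_neg (Fin.ne_last_of_lt hij)]
    split_ifs <;> linarith

theorem positiveSubsets_ne_lastPattern_iff (hv : SubsetGeneric v) (hm : StrictMono v) :
    positiveSubsets v ≠ lastPattern n ↔ ∃ p q, p ≠ q ∧ 0 < v p ∧ 0 < v q := by
  have hl : ∀ i : Fin (n + 2), {i} ∈ lastPattern n → i = Fin.last (n + 1) := by
    intro i hi
    exact (Finset.mem_singleton.1 hi.1).symm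
  constructor
  · intro h
    by_contra! hle
    refine h (positiveSubsets_eq_lastPattern hv.1 fun i hi => ?_)
    by_contra! hi0
    have h1 := hm (Fin.lt_last_iff_ne_last.2 hi)
    have h2 := hle (Fin.last (n + 1)) i hi.symm (lt_of_le_of_lt hi0 h1)
    refine hv.2 {i} (by simp) (fun hu => ?_) (by simpa using le_antisymm h2 hi0)
    have := Finset.mem_univ (Fin.last (n + 1))
    rw [← hu, Finset.mem_singleton] at this
    exact hi this.symm
  · rintro ⟨p, q, hpq, hp, hq⟩ h
    rw [← singleton_mem_positiveSubsets, h] at hp hq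
    exact hpq ((hl p hp).trans (hl q hq).symm)

theorem SubsetGeneric.exists_strictMono {m : ℕ} {v : Fin m → ℝ} (hv : SubsetGeneric v) :
    ∃ (w : Fin m → ℝ) (τ : Equiv.Perm (Fin m)), SubsetGeneric w ∧ StrictMono w ∧
      positiveSubsets w = positiveSubsets (v ∘ τ) := by
  obtain ⟨w, hw, hinj, hwv⟩ := hv.exists_injective
  exact ⟨w ∘ Tuple.sort w, Tuple.sort w, hw.comp _,
    (Tuple.monotone_sort w).strictMono_of_injective (hinj.comp (Equiv.injective _)),
    positiveSubsets_comp_congr hwv _⟩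

theorem exists_rankingPattern_eq (hv : SubsetGeneric v)
    (h : ∃ p q, p ≠ q ∧ 0 < v p ∧ 0 < v q) :
    ∃ μ : Fin (n + 2) → EuclideanSpace ℝ (Fin n),
      IsGenericUnfolding μ ∧ rankingPattern μ = weightRankings v := by
  obtain ⟨p, q, hpq, hp, hq⟩ := h
  obtain ⟨μ, hμ⟩ := exists_isAdapted_of_two_pos hv hpq hp hq
  exact ⟨μ, hμ.isGenericUnfolding hv, hμ.rankingPattern_eq⟩

/-- Increasing generic weights with two positive coordinates map onto both the classes and the
patterns other than `lastPattern`, with the same fibres. -/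
theorem numInequivalentRankingPatterns_add_one (n : ℕ) :
    numInequivalentRankingPatterns (n + 2) n + 1 = (increasingPatterns (n + 2)).ncard := by
  rw [← Set.ncard_sdiff_singleton_add_one (lastPattern_mem_increasingPatterns n) (Set.toFinite _),
    ← Nat.card_coe_set_eq, numInequivalentRankingPatterns, add_left_inj]
  let A := {v : Fin (n + 2) → ℝ //
    (SubsetGeneric v ∧ StrictMono v) ∧ ∃ p q, p ≠ q ∧ 0 < v p ∧ 0 < v q}
  let f : A → Quotient (rankingPatternSetoid (n + 2) n) := fun v =>
    Quotient.mk _ ⟨weightRankings v.1, exists_rankingPattern_eq v.2.1.1 v.2.2⟩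
  let g : A → (increasingPatterns (n + 2) \ {lastPattern n} : Set _) := fun v =>
    ⟨positiveSubsets v.1, ⟨v.1, v.2.1.1, v.2.1.2, rfl⟩,
      (positiveSubsets_ne_lastPattern_iff v.2.1.1 v.2.1.2).2 v.2.2⟩
  refine natCard_eq_of_surjective (f := f) (g := g) ?_ ?_ ?_
  · intro c
    induction c using Quotient.inductionOn with
    | h S =>
      obtain ⟨S, μ, hμ, rfl⟩ := S
      obtain ⟨v, hv, hvμ⟩ := hμ.exists_isAdapted
      obtain ⟨w, τ, hw, hwm, hwv⟩ := hv.exists_strictMono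
      have h2 : ∃ p q, p ≠ q ∧ 0 < w p ∧ 0 < w q := by
        obtain ⟨p, q, hpq, hp, hq⟩ := hvμ.exists_two_pos
        have hpos : ∀ i, 0 < v i → 0 < w (τ.symm i) := by
          intro i hi
          rw [← singleton_mem_positiveSubsets, hwv, singleton_mem_positiveSubsets]
          simpa using hi
        exact ⟨τ.symm p, τ.symm q, τ.symm.injective.ne hpq, hpos p hp, hpos q hq⟩
      refine ⟨⟨w, ⟨hw, hwm⟩, h2⟩, Quotient.sound ⟨τ, ?_⟩⟩
      change rankingPattern μ = (fun σ => τ * σ) '' weightRankings w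
      rw [(hw.weightRankings_eq_iff (hv.comp τ)).2 hwv, hvμ.rankingPattern_eq]
      exact weightRankings_comp v τ
  · rintro ⟨P, ⟨v, hv, hm, rfl⟩, hP⟩
    exact ⟨⟨v, ⟨hv, hm⟩, (positiveSubsets_ne_lastPattern_iff hv hm).1 hP⟩, rfl⟩
  · rintro ⟨v, ⟨hv, hvm⟩, hv2⟩ ⟨w, ⟨hw, hwm⟩, hw2⟩
    refine Iff.trans ?_ Subtype.ext_iff.symm
    change _ ↔ positiveSubsets v = positiveSubsets w
    constructor
    · intro h
      obtain ⟨τ, hτ⟩ := Quotient.exact h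
      change weightRankings w = (fun σ => τ * σ) '' weightRankings v at hτ
      rw [weightRankings_comp w τ] at hτ
      have h1 := (Set.image_injective.2 (mul_right_injective τ)) hτ
      rw [(hw.comp τ).weightRankings_eq_iff hv] at h1
      exact (positiveSubsets_eq_of_strictMono hw hvm hwm τ h1).symm
    · intro h
      refine Quotient.sound ⟨1, ?_⟩
      change weightRankings w = (fun σ => 1 * σ) '' weightRankings v
      rw [(hv.weightRankings_eq_iff hw).2 h]
      simp

end Classes

/-! ### Chambers of the joint arrangement -/

section Chambers

variable {m : ℕ}

/-- The union of the braid arrangement and the restricted all-subset arrangement. -/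
abbrev jointArrangement (m : ℕ) : Set (Set (H0 m)) :=
  braidArrangement m ∪ restrictedAllSubsetArrangement m

/-- The coordinates of a point of `H₀`. -/
def coords (x : H0 m) : Fin m → ℝ := fun i => (x : EuclideanSpace ℝ (Fin m)) i

theorem mem_compl_sUnion_jointArrangement {x : H0 m} :
    x ∈ (⋃₀ jointArrangement m)ᶜ ↔ SubsetGeneric (coords x) ∧ Function.Injective (coords x) := by
  simp only [Set.mem_compl_iff, Set.mem_sUnion, not_exists, not_and]
  constructor
  · intro h
    refine ⟨⟨x.2, fun I hI hI' h0 => h _ (Or.inr ⟨I, hI, hI', rfl⟩) h0⟩, fun i j hij => ?_⟩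
    rcases lt_trichotomy i j with hlt | heq | hlt
    · exact absurd hij (h _ (Or.inl ⟨i, j, hlt, rfl⟩))
    · exact heq
    · exact absurd hij.symm (h _ (Or.inl ⟨j, i, hlt, rfl⟩))
  · rintro ⟨hg, hinj⟩ H (⟨i, j, hij, rfl⟩ | ⟨I, hI, hI', rfl⟩) hx
    · exact hij.ne (hinj hx)
    · exact hg.2 I hI hI' hx

theorem IsPreconnected.pos_of_ne_zero {X : Type*} [TopologicalSpace X] {s : Set X}
    (hs : IsPreconnected s) {f : X → ℝ} (hf : ContinuousOn f s) (h0 : ∀ x ∈ s, f x ≠ 0)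
    {x y : X} (hx : x ∈ s) (hy : y ∈ s) (hfx : 0 < f x) : 0 < f y := by
  by_contra! hle
  obtain ⟨z, hz, hz0⟩ := hs.intermediate_value hy hx hf ⟨hle, hfx.le⟩
  exact h0 z hz hz0

theorem SubsetGeneric.combo {ι : Type*} [Fintype ι] {v w : ι → ℝ} (hv : SubsetGeneric v)
    (hw : SubsetGeneric w) (h : positiveSubsets v = positiveSubsets w) {a b : ℝ} (ha : 0 ≤ a)
    (hb : 0 ≤ b) (hab : a + b = 1) : SubsetGeneric fun i => a * v i + b * w i := by
  have hsum : ∀ I : Finset ι, ∑ i ∈ I, (a * v i + b * w i) =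
      a • ∑ i ∈ I, v i + b • ∑ i ∈ I, w i := by
    intro I
    rw [Finset.sum_add_distrib, ← Finset.mul_sum, ← Finset.mul_sum, smul_eq_mul, smul_eq_mul]
  refine ⟨by rw [hsum, hv.1, hw.1]; simp, fun I hI hI' => ?_⟩
  rw [hsum]
  by_cases hpos : I ∈ positiveSubsets v
  · exact (convex_Ioi (0 : ℝ) hpos (show I ∈ positiveSubsets w from h ▸ hpos) ha hb hab).ne'
  · exact (convex_Iio (0 : ℝ) ((hv.sum_neg_iff hI hI').2 hpos)
      ((hw.sum_neg_iff hI hI').2 (h ▸ hpos)) ha hb hab).ne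

/-- No defining linear form changes sign on a connected set avoiding the hyperplanes; conversely,
equal signs persist along the segment from `x` to `y`. -/
theorem connectedComponentIn_eq_iff {x y : H0 m} (hx : x ∈ (⋃₀ jointArrangement m)ᶜ)
    (hy : y ∈ (⋃₀ jointArrangement m)ᶜ) :
    connectedComponentIn (⋃₀ jointArrangement m)ᶜ x =
        connectedComponentIn (⋃₀ jointArrangement m)ᶜ y ↔
      (∀ i j, coords x i < coords x j → coords y i < coords y j) ∧
        positiveSubsets (coords x) = positiveSubsets (coords y) := by
  have hcont : ∀ i, Continuous fun z : H0 m => coords z i := by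
    intro i
    unfold coords
    fun_prop
  obtain ⟨hgx, hix⟩ := mem_compl_sUnion_jointArrangement.1 hx
  obtain ⟨hgy, hiy⟩ := mem_compl_sUnion_jointArrangement.1 hy
  constructor
  · intro h
    have hs : IsPreconnected (connectedComponentIn (⋃₀ jointArrangement m)ᶜ y) :=
      isPreconnected_connectedComponentIn
    have hxs := mem_connectedComponentIn hx
    rw [h] at hxs
    have hys := mem_connectedComponentIn hy
    have hsub := fun z (hz : z ∈ connectedComponentIn (⋃₀ jointArrangement m)ᶜ y) =>
      mem_compl_sUnion_jointArrangement.1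
      (connectedComponentIn_subset (⋃₀ jointArrangement m)ᶜ y hz)
    constructor
    · intro i j hij
      have hne : i ≠ j := by
        rintro rfl
        exact lt_irrefl _ hij
      refine sub_pos.1 (hs.pos_of_ne_zero (f := fun z => coords z j - coords z i)
        ((hcont j).sub (hcont i)).continuousOn (fun z hz h0 => ?_) hxs hys (sub_pos.2 hij))
      exact hne ((hsub z hz).2 (sub_eq_zero.1 h0)).symm
    · refine ((hgy.positiveSubsets_eq_iff hgx).2 fun I hI => ?_).symm
      refine hs.pos_of_ne_zero (f := fun z => ∑ i ∈ I, coords z i)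
        (continuous_finsetSum I fun i _ => hcont i).continuousOn (fun z hz => ?_) hxs hys hI
      refine (hsub z hz).1.2 I ?_ ?_
      · rw [Finset.nonempty_iff_ne_empty]
        rintro rfl
        simp [positiveSubsets] at hI
      · rintro rfl
        simp [positiveSubsets, hgx.1] at hI
  · rintro ⟨hlt, hP⟩
    refine connectedComponentIn_eq ?_
    refine (convex_segment x y).isPreconnected.subset_connectedComponentIn
      (left_mem_segment ℝ x y) ?_ (right_mem_segment ℝ x y)
    rintro z ⟨a, b, ha, hb, hab, rfl⟩
    rw [mem_compl_sUnion_jointArrangement]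
    refine ⟨hgx.combo hgy hP ha hb hab, ?_⟩
    have hlt' : ∀ i j, coords x i < coords x j →
        coords (a • x + b • y) i < coords (a • x + b • y) j := by
      intro i j hij
      have := convex_Ioi (0 : ℝ) (sub_pos.2 hij : _ ∈ Set.Ioi (0 : ℝ))
        (sub_pos.2 (hlt i j hij) : _ ∈ Set.Ioi (0 : ℝ)) ha hb hab
      simp only [Set.mem_Ioi, smul_eq_mul] at this
      change a * coords x i + b * coords y i < a * coords x j + b * coords y j
      linarith
    intro i j hij
    by_contra hne
    rcases lt_or_gt_of_ne (hix.ne hne) with h | h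
    · exact (hlt' i j h).ne hij
    · exact (hlt' j i h).ne' hij

theorem sort_eq_of_strictMono_comp {v : Fin m → ℝ} {σ : Equiv.Perm (Fin m)}
    (h : StrictMono (v ∘ σ)) : Tuple.sort v = σ := by
  symm
  rw [Tuple.eq_sort_iff]
  exact ⟨h.monotone, fun i j hij he => absurd he (h hij).ne⟩

theorem strictMono_comp_sort {v : Fin m → ℝ} (h : Function.Injective v) :
    StrictMono (v ∘ Tuple.sort v) :=
  (Tuple.monotone_sort v).strictMono_of_injective (h.comp (Equiv.injective _))

/-- A chamber is recorded by its sorting permutation and the sign pattern of the sorted point, and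
these two data are independent. -/
theorem ncard_chambers_jointArrangement (m : ℕ) :
    (chambers (jointArrangement m)).ncard = m.factorial * (increasingPatterns m).ncard := by
  have hperm : Nat.card (Equiv.Perm (Fin m)) = m.factorial := by
    rw [Nat.card_perm, Nat.card_fin]
  rw [← hperm, ← Nat.card_coe_set_eq, ← Nat.card_coe_set_eq, ← Nat.card_prod]
  let A := {x : H0 m // x ∈ (⋃₀ jointArrangement m)ᶜ}
  let f : A → chambers (jointArrangement m) := fun x =>
    ⟨connectedComponentIn (⋃₀ jointArrangement m)ᶜ x.1, x.1, x.2, rfl⟩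
  have hA : ∀ x : A, SubsetGeneric (coords x.1) ∧ Function.Injective (coords x.1) := fun x =>
    mem_compl_sUnion_jointArrangement.1 x.2
  let g : A → Equiv.Perm (Fin m) × increasingPatterns m := fun x =>
    ⟨Tuple.sort (coords x.1), positiveSubsets (coords x.1 ∘ Tuple.sort (coords x.1)),
      _, (hA x).1.comp _, strictMono_comp_sort (hA x).2, rfl⟩
  refine natCard_eq_of_surjective (f := f) (g := g) ?_ ?_ ?_
  · rintro ⟨_, x, hx, rfl⟩
    exact ⟨⟨x, hx⟩, rfl⟩
  · rintro ⟨σ, P, v, hv, hm, rfl⟩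
    have hw : SubsetGeneric (v ∘ σ.symm) := hv.comp σ.symm
    let x : H0 m := ⟨WithLp.toLp 2 (v ∘ σ.symm), hw.1⟩
    have hcomp : (v ∘ σ.symm) ∘ σ = v := by
      ext i
      simp
    have hsort : Tuple.sort (v ∘ σ.symm) = σ :=
      sort_eq_of_strictMono_comp (by rwa [hcomp])
    refine ⟨⟨x, mem_compl_sUnion_jointArrangement.2
      ⟨hw, hm.injective.comp σ.symm.injective⟩⟩, ?_⟩
    refine Prod.ext hsort (Subtype.ext ?_)
    change positiveSubsets ((v ∘ σ.symm) ∘ Tuple.sort (v ∘ σ.symm)) = positiveSubsets v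
    rw [hsort, hcomp]
  · intro x y
    rw [Subtype.ext_iff, Prod.ext_iff, Subtype.ext_iff]
    refine (connectedComponentIn_eq_iff x.2 y.2).trans ?_
    change _ ↔ Tuple.sort (coords x.1) = Tuple.sort (coords y.1) ∧
      positiveSubsets (coords x.1 ∘ Tuple.sort (coords x.1)) =
        positiveSubsets (coords y.1 ∘ Tuple.sort (coords y.1))
    constructor
    · rintro ⟨hlt, hP⟩
      have hs : Tuple.sort (coords y.1) = Tuple.sort (coords x.1) :=
        sort_eq_of_strictMono_comp fun i j hij => hlt _ _ (strictMono_comp_sort (hA x).2 hij)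
      exact ⟨hs.symm, by rw [hs]; exact positiveSubsets_comp_congr hP _⟩
    · rintro ⟨hs, hP⟩
      constructor
      · intro i j hij
        have hx := strictMono_comp_sort (hA x).2
        have hy := strictMono_comp_sort (hA y).2
        have h1 : (Tuple.sort (coords x.1)).symm i < (Tuple.sort (coords x.1)).symm j := by
          rw [← hx.lt_iff_lt]
          simpa using hij
        rw [hs] at h1
        simpa using hy h1
      · have := positiveSubsets_comp_congr hP (Tuple.sort (coords x.1)).symm
        rw [← hs] at this
        simpa [Function.comp_assoc] using this

end Chambers

/-- For `m` objects, the unfolding model has codimension one when its dimension is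
`n = m - 2`. -/
theorem mainTheorem3 (m n : ℕ) (hmn : m = n + 2) :
    (numInequivalentRankingPatterns m n : ℚ) =
      ((chambers (braidArrangement m ∪ restrictedAllSubsetArrangement m)).ncard : ℚ) /
        (Nat.factorial m : ℚ) - 1 := by
  subst hmn
  have h0 : (Nat.factorial (n + 2) : ℚ) ≠ 0 := by exact_mod_cast Nat.factorial_ne_zero _
  rw [ncard_chambers_jointArrangement, ← numInequivalentRankingPatterns_add_one]
  push_cast
  rw [mul_div_cancel_left₀ _ h0]
  ring
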